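/- Let $c>1$ be a real number. Then there is a continuous function $f:[0,1]\to\mathbb R$ such that (a) $f$ is almost nowhere differentiable: for Lebesgue-almost every $x\in[0,1]$, $f$ has no derivative at $x$, neither finite nor infinite, i.e. the difference quotient $\frac{f(y)-f(x)}{y-x}$ has no limit in $[-\infty,\infty]$ as $y\to x$, $y\in[0,1]\setminus\{x\}$; and (b) the graph $\{(x,f(x)):x\in[0,1]\}\subset\mathbb R^2$, with the Euclidean metric $d$, is symmetrically $c$-monotone: there is a linear order $<$ on the graph such that $\max\bigl(d(p,q),d(q,r)\bigr)\le c\,d(p,r)$ for all points $p<q<r$ of the graph. -/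

import Mathlib

/-- A metric space is symmetrically `c`-monotone if some linear order `<` on it satisfies
`max (d(x,y), d(y,z)) ≤ c d(x,z)` whenever `x < y < z`. The order need not be related to the
topology. -/
def SymmetricallyMonotone (c : ℝ) (X : Type*) [MetricSpace X] : Prop :=
  ∃ _ : LinearOrder X, ∀ x y z : X, x < y → y < z →
    max (dist x y) (dist y z) ≤ c * dist x z

/-- The graph of `f` over `s`, as a subset of the Euclidean plane. -/
def planeGraph (f : ℝ → ℝ) (s : Set ℝ) : Set (EuclideanSpace ℝ (Fin 2)) :=
  (fun x : ℝ => !₂[x, f x]) '' s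

/-- `f`, as a function on `s`, has a derivative at `x`, finite or infinite: the difference
quotients `(f y - f x) / (y - x)` converge in `[-∞, ∞]` as `y → x`, `y ∈ s`, `y ≠ x`. -/
def HasFiniteOrInfiniteDeriv (f : ℝ → ℝ) (s : Set ℝ) (x : ℝ) : Prop :=
  ∃ L : EReal, Filter.Tendsto (fun y : ℝ => (((f y - f x) / (y - x) : ℝ) : EReal))
    (nhdsWithin x (s \ {x})) (nhds L)

/-- At Lebesgue almost every point of `s`, `f` as a function on `s` has no derivative, neither
a finite nor an infinite one. -/
def AlmostNowhereDifferentiableOn (f : ℝ → ℝ) (s : Set ℝ) : Prop :=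
  ∀ᵐ x ∂(MeasureTheory.volume.restrict s), ¬ HasFiniteOrInfiniteDeriv f s x

open Filter Topology MeasureTheory Set

/-! The function is `ε * waveSum`, where `waveSum` is a Takagi-type sum of triangular waves with
slopes `±1` at scales `2 ^ (-j)`, and the graph is ordered by abscissa. Kinks of different levels
stay apart, so on `[x, z]` the waves coarser than `z - x` have at most one kinked member, and the
finer waves contribute only `O(z - x)`. Hence `waveSum` is affine up to `5 * (z - x)` on every
interval (`exists_abs_waveSum_sub_le`). For small `ε` the graph is then nearly straight at every
scale, which gives monotonicity with constant `c` (`symmetricallyMonotone_planeGraph`). Over the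
dyadic intervals around a point the difference quotients are partial sums of a series of terms `±1`,
so no finite derivative exists (`not_differentiableAt_waveSum`). Infinite derivatives are excluded
almost everywhere for any real function. -/

/-! ### Infinite derivatives occur on a null set only -/

/-- Where all difference quotients of `f` over steps shorter than `r` are nonnegative, `f` is
monotone on short intervals; hence an infinite derivative is exceptional there. -/
theorem ae_not_tendsto_slope_atTop_of_nonneg (f : ℝ → ℝ) (a r : ℝ) :
    ∀ᵐ x, x ∈ Ioo a (a + r) → (∀ y, |y - x| < r → 0 ≤ slope f x y) →
      ¬ Tendsto (slope f x) (𝓝[≠] x) atTop := by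
  set E : Set ℝ := {x | x ∈ Ioo a (a + r) ∧ ∀ y, |y - x| < r → 0 ≤ slope f x y} with hE
  have hmono : MonotoneOn f E := by
    rintro x ⟨hx, hx'⟩ y ⟨hy, -⟩ hxy
    rcases hxy.eq_or_lt with rfl | hlt
    · exact le_rfl
    have h := hx' y (by rw [abs_lt]; constructor <;> linarith [hx.1, hx.2, hy.1, hy.2])
    rw [slope_def_field, le_div_iff₀ (sub_pos.2 hlt)] at h
    linarith
  -- Away from countably many points, `x` is a limit of points of `E` from the right; there the
  -- finite derivative along `E` contradicts an infinite limit.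
  have hiso : ∀ᵐ x, x ∉ {x | x ∈ E ∧ 𝓝[E ∩ Ioi x] x = ⊥} :=
    countable_setOfPred_isolated_right_within.ae_notMem volume
  filter_upwards [hmono.ae_differentiableWithinAt_of_mem, hiso] with x hx hx' hxI hxs htop
  have hxE : x ∈ E := ⟨hxI, hxs⟩
  have hne : (𝓝[E ∩ Ioi x] x).NeBot := ⟨fun h => hx' ⟨hxE, h⟩⟩
  have hle : 𝓝[E ∩ Ioi x] x ≤ 𝓝[E \ {x}] x :=
    nhdsWithin_mono x fun y hy => ⟨hy.1, (ne_of_gt hy.2 : y ≠ x)⟩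
  have hfin := (hasDerivWithinAt_iff_tendsto_slope.1 (hx hxE).hasDerivWithinAt).mono_left hle
  exact not_tendsto_nhds_of_tendsto_atTop
    (htop.mono_left (hle.trans (nhdsWithin_mono x fun y hy => hy.2))) _ hfin

/-- The derivative of a real function is `+∞` on a null set only. -/
theorem ae_not_tendsto_slope_atTop (f : ℝ → ℝ) :
    ∀ᵐ x, ¬ Tendsto (slope f x) (𝓝[≠] x) atTop := by
  have h : ∀ᵐ x, ∀ (n : ℕ) (q : ℚ), x ∈ Ioo (q : ℝ) (q + 1 / ((n : ℝ) + 1)) →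
      (∀ y, |y - x| < 1 / ((n : ℝ) + 1) → 0 ≤ slope f x y) →
        ¬ Tendsto (slope f x) (𝓝[≠] x) atTop :=
    ae_all_iff.2 fun n => ae_all_iff.2 fun q => ae_not_tendsto_slope_atTop_of_nonneg f q _
  filter_upwards [h] with x hx htop
  have hev := htop.eventually_ge_atTop 0
  rw [eventually_nhdsWithin_iff, Metric.eventually_nhds_iff] at hev
  obtain ⟨r, hr, hball⟩ := hev
  obtain ⟨n, hn⟩ := exists_nat_one_div_lt hr
  have hn0 : 0 < 1 / ((n : ℝ) + 1) := by positivity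
  obtain ⟨q, hq⟩ := exists_rat_btwn (sub_lt_self x hn0)
  refine hx n q ⟨hq.2, by linarith⟩ (fun y hy => ?_) htop
  rcases eq_or_ne y x with rfl | hne
  -- By convention `slope f x x = 0`.
  · simp
  · exact hball (by rw [Real.dist_eq]; linarith) hne

/-- The derivative of a real function is `-∞` on a null set only. -/
theorem ae_not_tendsto_slope_atBot (f : ℝ → ℝ) :
    ∀ᵐ x, ¬ Tendsto (slope f x) (𝓝[≠] x) atBot := by
  filter_upwards [ae_not_tendsto_slope_atTop (-f)] with x hx hbot
  refine hx ((tendsto_neg_atBot_atTop.comp hbot).congr fun y => ?_)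
  simp only [Function.comp_apply, slope_def_field, Pi.neg_apply]
  ring

/-- A function on an interval that is nowhere differentiable in the finite sense is almost nowhere
differentiable, even when infinite derivatives are admitted. -/
theorem almostNowhereDifferentiableOn_Icc {f : ℝ → ℝ} (a b : ℝ)
    (hf : ∀ x, ¬ DifferentiableAt ℝ f x) : AlmostNowhereDifferentiableOn f (Icc a b) := by
  -- The endpoints are null; at interior points the limit within the interval is the two-sided one.
  rw [AlmostNowhereDifferentiableOn, restrict_Ioo_eq_restrict_Icc.symm,
    ae_restrict_iff' measurableSet_Ioo]
  filter_upwards [ae_not_tendsto_slope_atTop f, ae_not_tendsto_slope_atBot f]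
    with x htop hbot hx ⟨L, hL⟩
  have hnhds : 𝓝[Icc a b \ {x}] x = 𝓝[≠] x := by
    rw [sdiff_eq, inter_comm]
    exact nhdsWithin_inter_of_mem' (mem_nhdsWithin_of_mem_nhds (Icc_mem_nhds hx.1 hx.2))
  simp only [hnhds, ← slope_def_field] at hL
  induction L with
  | bot => exact hbot (EReal.tendsto_coe_nhds_bot_iff.1 hL)
  | top => exact htop (EReal.tendsto_coe_nhds_top_iff.1 hL)
  | coe L =>
    exact hf x (hasDerivAt_iff_tendsto_slope.2 (EReal.tendsto_coe.1 hL)).differentiableAt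

/-! ### The triangular wave -/

/-- At a tie `round t` may differ from `i`, but both are then at distance `1 / 2`. -/
theorem abs_sub_round_eq_abs_sub {t : ℝ} {i : ℤ} (h : |t - i| ≤ 1 / 2) :
    |t - round t| = |t - i| := by
  refine le_antisymm (round_le t i) ?_
  rcases eq_or_ne (round t) i with hi | hi
  · rw [hi]
  have h1 : (1 : ℝ) ≤ |(round t : ℝ) - i| := by
    exact_mod_cast Int.one_le_abs (sub_ne_zero.2 hi)
  have h2 : |(round t : ℝ) - i| ≤ |t - round t| + |t - i| := by
    rw [abs_sub_comm t (round t)]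
    exact abs_sub_le _ _ _
  linarith

/-- The triangular wave of period `2` and slopes `±1` that vanishes exactly at the integers. -/
noncomputable def triangleWave (x : ℝ) : ℝ :=
  1 / 2 - 2 * |(x - 1 / 2) / 2 - round ((x - 1 / 2) / 2)|

theorem abs_triangleWave_le (x : ℝ) : |triangleWave x| ≤ 1 / 2 := by
  have h1 := abs_sub_round ((x - 1 / 2) / 2)
  have h2 := abs_nonneg ((x - 1 / 2) / 2 - round ((x - 1 / 2) / 2))
  rw [triangleWave, abs_le]
  constructor <;> linarith

theorem abs_triangleWave_sub_le (x y : ℝ) : |triangleWave x - triangleWave y| ≤ |x - y| := by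
  have key : ∀ s t : ℝ, |s - round s| - |t - round t| ≤ |s - t| := fun s t => by
    have h1 := round_le s (round t)
    have h2 := abs_sub_le s t (round t)
    linarith
  have h1 := key ((x - 1 / 2) / 2) ((y - 1 / 2) / 2)
  have h2 := key ((y - 1 / 2) / 2) ((x - 1 / 2) / 2)
  have h3 : |(x - 1 / 2) / 2 - (y - 1 / 2) / 2| = |x - y| / 2 := by
    rw [← abs_of_pos (two_pos : (0 : ℝ) < 2), ← abs_div, abs_of_pos (two_pos : (0 : ℝ) < 2)]
    congr 1
    ring
  rw [abs_sub_comm ((y - 1 / 2) / 2) ((x - 1 / 2) / 2), h3] at h2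
  rw [h3] at h1
  rw [triangleWave, triangleWave, abs_le]
  constructor <;> linarith

theorem continuous_triangleWave : Continuous triangleWave :=
  (LipschitzWith.of_dist_le' (K := 1) fun x y => by
    simpa [Real.dist_eq] using abs_triangleWave_sub_le x y).continuous

/-- Between consecutive half-integers the triangular wave is affine with slope `±1`. -/
theorem exists_triangleWave_eq (m : ℤ) :
    ∃ σ : ℝ, |σ| = 1 ∧ ∀ x : ℝ, |x - m| ≤ 1 / 2 → triangleWave x = σ * (x - m) := by
  rcases Int.even_or_odd' m with ⟨i, rfl | rfl⟩
  · refine ⟨1, by simp, fun x hx => ?_⟩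
    rw [abs_le] at hx
    push_cast at hx ⊢
    have h0 : (x - 1 / 2) / 2 - i ≤ 0 := by linarith
    rw [triangleWave, abs_sub_round_eq_abs_sub (i := i), abs_of_nonpos h0]
    · ring
    · rw [abs_of_nonpos h0]; linarith
  · refine ⟨-1, by simp, fun x hx => ?_⟩
    rw [abs_le] at hx
    push_cast at hx ⊢
    have h0 : 0 ≤ (x - 1 / 2) / 2 - i := by linarith
    rw [triangleWave, abs_sub_round_eq_abs_sub (i := i), abs_of_nonneg h0]
    · ring
    · rw [abs_of_nonneg h0]; linarith

theorem triangleWave_intCast (m : ℤ) : triangleWave m = 0 := by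
  obtain ⟨σ, -, h⟩ := exists_triangleWave_eq m
  rw [h m (by norm_num)]
  simp

/-! ### Rescaled waves -/

/-- The triangular wave rescaled by the factor `2 ^ (-j)`. -/
noncomputable def scaledWave (j : ℕ) (x : ℝ) : ℝ :=
  triangleWave (2 ^ j * x) / 2 ^ j

theorem abs_scaledWave_le (j : ℕ) (x : ℝ) : |scaledWave j x| ≤ (1 / 2) ^ j / 2 := by
  have h := abs_triangleWave_le (2 ^ j * x)
  have e : (1 / 2 : ℝ) ^ j / 2 = 1 / 2 / 2 ^ j := by rw [one_div_pow]; ring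
  rw [scaledWave, abs_div, abs_of_pos (by positivity : (0 : ℝ) < 2 ^ j), e]
  gcongr

theorem abs_scaledWave_sub_le (j : ℕ) (x y : ℝ) :
    |scaledWave j x - scaledWave j y| ≤ |x - y| := by
  have hp : (0 : ℝ) < 2 ^ j := by positivity
  have h := abs_triangleWave_sub_le (2 ^ j * x) (2 ^ j * y)
  rw [← mul_sub, abs_mul, abs_of_pos hp] at h
  rw [scaledWave, scaledWave, ← sub_div, abs_div, abs_of_pos hp, div_le_iff₀ hp]
  linarith

theorem continuous_scaledWave (j : ℕ) : Continuous (scaledWave j) :=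
  (continuous_triangleWave.comp (continuous_const.mul continuous_id)).div_const _

theorem exists_scaledWave_sub_eq (j : ℕ) (m : ℤ) :
    ∃ σ : ℝ, |σ| = 1 ∧ ∀ u v : ℝ, |2 ^ j * u - m| ≤ 1 / 2 → |2 ^ j * v - m| ≤ 1 / 2 →
      scaledWave j u - scaledWave j v = σ * (u - v) := by
  obtain ⟨σ, hσ, h⟩ := exists_triangleWave_eq m
  refine ⟨σ, hσ, fun u v hu hv => ?_⟩
  rw [scaledWave, scaledWave, h _ hu, h _ hv]
  field_simp
  ring

/-- `scaledWave j` is affine on an interval without kinks in its interior. -/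
theorem exists_scaledWave_affineOn_or_kink (j : ℕ) (x z : ℝ) :
    (∃ s : ℝ, ∀ u ∈ Icc x z, ∀ v ∈ Icc x z, scaledWave j u - scaledWave j v = s * (u - v)) ∨
      ∃ m : ℤ, 2 ^ j * x < m + 1 / 2 ∧ (m : ℝ) + 1 / 2 < 2 ^ j * z := by
  have hp : (0 : ℝ) < 2 ^ j := by positivity
  set m : ℤ := ⌊(2 : ℝ) ^ j * x + 1 / 2⌋
  have h1 : (m : ℝ) ≤ 2 ^ j * x + 1 / 2 := Int.floor_le _
  have h2 : (2 : ℝ) ^ j * x + 1 / 2 < m + 1 := Int.lt_floor_add_one _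
  rcases le_or_gt (2 ^ j * z) ((m : ℝ) + 1 / 2) with hz | hz
  · left
    obtain ⟨σ, -, h⟩ := exists_scaledWave_sub_eq j m
    have hm : ∀ u ∈ Icc x z, |2 ^ j * u - (m : ℝ)| ≤ 1 / 2 := fun u hu => by
      have h3 := mul_le_mul_of_nonneg_left hu.1 hp.le
      have h4 := mul_le_mul_of_nonneg_left hu.2 hp.le
      rw [abs_le]
      constructor <;> linarith
    exact ⟨σ, fun u hu v hv => h u v (hm u hu) (hm v hv)⟩
  · exact Or.inr ⟨m, by linarith, hz⟩

/-- Kinks of two different levels keep a distance of half a period of the finer wave. -/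
theorem one_lt_of_kinks {i j : ℕ} (hij : i < j) {x z : ℝ} {a b : ℤ}
    (ha : 2 ^ i * x < (a : ℝ) + 1 / 2) (ha' : (a : ℝ) + 1 / 2 < 2 ^ i * z)
    (hb : 2 ^ j * x < (b : ℝ) + 1 / 2) (hb' : (b : ℝ) + 1 / 2 < 2 ^ j * z) :
    1 < 2 ^ j * (2 * (z - x)) := by
  obtain ⟨d, rfl⟩ := Nat.exists_eq_add_of_lt hij
  have hd : (0 : ℝ) < 2 ^ (d + 1) := by positivity
  have h1 := mul_lt_mul_of_pos_left ha hd
  have h2 := mul_lt_mul_of_pos_left ha' hd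
  -- In the coordinate `2 ^ j * t` the coarser kink is the integer `N`, hence at least `1 / 2` away
  -- from `b + 1 / 2`.
  set N : ℤ := 2 ^ (d + 1) * a + 2 ^ d with hN
  have hNr : (N : ℝ) = 2 ^ (d + 1) * (a + 1 / 2) := by
    rw [hN]; push_cast; ring
  have e : ∀ t : ℝ, (2 : ℝ) ^ (i + d + 1) * t = 2 ^ (d + 1) * (2 ^ i * t) := fun t => by ring
  rw [← hNr, ← e] at h1 h2
  have h3 : (2 : ℝ) ^ (i + d + 1) * (2 * (z - x)) =
      2 * (2 ^ (i + d + 1) * z - 2 ^ (i + d + 1) * x) := by ring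
  rw [h3]
  rcases le_or_gt N b with h | h
  · have h' : (N : ℝ) ≤ b := by exact_mod_cast h
    linarith
  · have h' : (b : ℝ) + 1 ≤ N := by exact_mod_cast h
    linarith

/-- On an interval that is short with respect to the first `n` waves, the sum of these waves is
affine up to a `1`-Lipschitz error. -/
theorem exists_abs_sum_scaledWave_sub_le (n : ℕ) {x z : ℝ}
    (hn : ∀ j < n, 2 ^ j * (2 * (z - x)) ≤ 1) :
    ∃ s : ℝ, ∀ u ∈ Icc x z, ∀ v ∈ Icc x z,
      |∑ j ∈ Finset.range n, (scaledWave j u - scaledWave j v) - s * (u - v)| ≤ |u - v| := by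
  by_cases hall : ∀ j < n, ∃ s : ℝ, ∀ u ∈ Icc x z, ∀ v ∈ Icc x z,
      scaledWave j u - scaledWave j v = s * (u - v)
  · choose! s hs using hall
    refine ⟨∑ j ∈ Finset.range n, s j, fun u hu v hv => ?_⟩
    rw [Finset.sum_congr rfl fun j hj => hs j (Finset.mem_range.1 hj) u hu v hv,
      ← Finset.sum_mul, sub_self, abs_zero]
    exact abs_nonneg _
  · push Not at hall
    obtain ⟨j₀, hj₀, hbad⟩ := hall
    have hkink : ∃ m : ℤ, 2 ^ j₀ * x < m + 1 / 2 ∧ (m : ℝ) + 1 / 2 < 2 ^ j₀ * z := by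
      refine (exists_scaledWave_affineOn_or_kink j₀ x z).resolve_left ?_
      push Not
      exact hbad
    obtain ⟨m, hm, hm'⟩ := hkink
    -- A second kinked level would make the interval too long, so wave `j₀` alone causes the error.
    have hgood : ∀ j ∈ (Finset.range n).erase j₀, ∃ s : ℝ, ∀ u ∈ Icc x z, ∀ v ∈ Icc x z,
        scaledWave j u - scaledWave j v = s * (u - v) := by
      intro j hj
      rw [Finset.mem_erase, Finset.mem_range] at hj
      refine (exists_scaledWave_affineOn_or_kink j x z).resolve_right ?_
      rintro ⟨l, hl, hl'⟩
      rcases lt_or_gt_of_ne hj.1 with h | h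
      · exact (hn j₀ hj₀).not_gt (one_lt_of_kinks h hl hl' hm hm')
      · exact (hn j hj.2).not_gt (one_lt_of_kinks h hm hm' hl hl')
    choose! s hs using hgood
    refine ⟨∑ j ∈ (Finset.range n).erase j₀, s j, fun u hu v hv => ?_⟩
    rw [← Finset.add_sum_erase _ _ (Finset.mem_range.2 hj₀),
      Finset.sum_congr rfl fun j hj => hs j hj u hu v hv, ← Finset.sum_mul, add_sub_cancel_right]
    exact abs_scaledWave_sub_le j₀ u v

/-! ### The sum of the waves -/

/-- A function of Takagi type: the sum of the rescaled triangular waves. The waves are placed so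
that no two of them have a kink in common. -/
noncomputable def waveSum (x : ℝ) : ℝ :=
  ∑' j, scaledWave j x

theorem summable_scaledWave (x : ℝ) : Summable fun j => scaledWave j x :=
  Summable.of_norm_bounded (summable_geometric_two.div_const 2) fun j => abs_scaledWave_le j x

theorem continuous_waveSum : Continuous waveSum :=
  continuous_tsum continuous_scaledWave (summable_geometric_two.div_const 2) abs_scaledWave_le

theorem abs_tsum_scaledWave_tail_le (n : ℕ) (x : ℝ) :
    |∑' j, scaledWave (j + n) x| ≤ (1 / 2) ^ n := by
  have hsum : HasSum (fun j : ℕ => ((1 : ℝ) / 2) ^ (j + n) / 2) ((1 / 2) ^ n) := by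
    have h := hasSum_geometric_two.mul_left (((1 : ℝ) / 2) ^ n / 2)
    rw [div_mul_cancel₀ _ two_ne_zero] at h
    have e : (fun j : ℕ => ((1 : ℝ) / 2) ^ (j + n) / 2) =
        fun j => (1 / 2) ^ n / 2 * (1 / 2) ^ j := by
      funext j
      rw [pow_add]
      ring
    rwa [e]
  exact tsum_of_norm_bounded (f := fun j => scaledWave (j + n) x) hsum fun j => abs_scaledWave_le (j + n) x

theorem waveSum_eq_sum_add_tail (n : ℕ) (x : ℝ) :
    waveSum x = ∑ j ∈ Finset.range n, scaledWave j x + ∑' j, scaledWave (j + n) x :=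
  ((summable_scaledWave x).sum_add_tsum_nat_add n).symm

/-- On every interval `waveSum` is affine up to an error proportional to the length. -/
theorem exists_abs_waveSum_sub_le {x z : ℝ} (hxz : x < z) :
    ∃ s : ℝ, ∀ u ∈ Icc x z, ∀ v ∈ Icc x z,
      |waveSum u - waveSum v - s * (u - v)| ≤ 5 * (z - x) := by
  have hδ : 0 < 2 * (z - x) := by linarith
  have hex : ∃ n : ℕ, ((1 : ℝ) / 2) ^ n < 2 * (z - x) :=
    exists_pow_lt_of_lt_one hδ (by norm_num)
  classical
  -- The two tails from level `n` on cost less than `2 * (z - x)` each and the kinked wave at most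
  -- `z - x`, whence the factor `5`.
  set n := Nat.find hex
  have hn : ((1 : ℝ) / 2) ^ n < 2 * (z - x) := Nat.find_spec hex
  have hlt : ∀ j < n, 2 ^ j * (2 * (z - x)) ≤ 1 := fun j hj => by
    have h := not_lt.1 (Nat.find_min hex hj)
    rwa [one_div_pow, le_div_iff₀ (by positivity), mul_comm] at h
  obtain ⟨s, hs⟩ := exists_abs_sum_scaledWave_sub_le n hlt
  refine ⟨s, fun u hu v hv => ?_⟩
  have h1 := hs u hu v hv
  have h2 := abs_tsum_scaledWave_tail_le n u
  have h3 := abs_tsum_scaledWave_tail_le n v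
  have h4 : |u - v| ≤ z - x := by
    rw [abs_le]
    constructor <;> linarith [hu.1, hu.2, hv.1, hv.2]
  rw [Finset.sum_sub_distrib] at h1
  rw [waveSum_eq_sum_add_tail n u, waveSum_eq_sum_add_tail n v]
  rw [abs_le] at h1 h2 h3 ⊢
  constructor <;> linarith

/-! ### Nowhere differentiability -/

/-- Dyadic points of order `n` are zeros of every wave from level `n` on. -/
theorem waveSum_eq_sum_of_dyadic (n : ℕ) (m : ℤ) :
    waveSum (m / 2 ^ n) = ∑ j ∈ Finset.range n, scaledWave j (m / 2 ^ n) := by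
  rw [waveSum_eq_sum_add_tail n, add_eq_left]
  have h : ∀ j, scaledWave (j + n) ((m : ℝ) / 2 ^ n) = 0 := fun j => by
    have e : (2 : ℝ) ^ (j + n) * (m / 2 ^ n) = ((2 ^ j * m : ℤ) : ℝ) := by
      push_cast
      field_simp
      ring
    rw [scaledWave, e, triangleWave_intCast, zero_div]
  simp [h]

/-- Together with its antitone counterpart, this nests the dyadic intervals around `x`, so one slope
per level serves all finer intervals. -/
theorem monotone_dyadic_floor (x : ℝ) : Monotone fun k : ℕ => (⌊2 ^ k * x⌋ : ℝ) / 2 ^ k := by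
  refine monotone_nat_of_le_succ fun k => ?_
  have h : 2 * ⌊2 ^ k * x⌋ ≤ ⌊2 ^ (k + 1) * x⌋ := Int.le_floor.2 <| by
    push_cast
    rw [pow_succ']
    linarith [Int.floor_le (2 ^ k * x)]
  have h' : 2 * (⌊2 ^ k * x⌋ : ℝ) ≤ ⌊2 ^ (k + 1) * x⌋ := by exact_mod_cast h
  have hp : (0 : ℝ) < 2 ^ k := by positivity
  have e : (2 : ℝ) ^ (k + 1) = 2 * 2 ^ k := pow_succ' 2 k
  rw [div_le_div_iff₀ (by positivity) (by positivity)]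
  linear_combination 2 ^ k * h' + (⌊2 ^ k * x⌋ : ℝ) * e

theorem antitone_dyadic_floor_add_one (x : ℝ) :
    Antitone fun k : ℕ => ((⌊2 ^ k * x⌋ + 1 : ℤ) : ℝ) / 2 ^ k := by
  refine antitone_nat_of_succ_le fun k => ?_
  have h : ⌊2 ^ (k + 1) * x⌋ < 2 * (⌊2 ^ k * x⌋ + 1) := Int.floor_lt.2 <| by
    push_cast
    rw [pow_succ']
    linarith [Int.lt_floor_add_one (2 ^ k * x)]
  have h' : ((⌊2 ^ (k + 1) * x⌋ + 1 : ℤ) : ℝ) ≤ 2 * ((⌊2 ^ k * x⌋ + 1 : ℤ) : ℝ) := by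
    exact_mod_cast h
  have hp : (0 : ℝ) < 2 ^ k := by positivity
  have e : (2 : ℝ) ^ (k + 1) = 2 * 2 ^ k := pow_succ' 2 k
  rw [div_le_div_iff₀ (by positivity) (by positivity)]
  linear_combination 2 ^ k * h' + -((⌊2 ^ k * x⌋ + 1 : ℤ) : ℝ) * e

/-- `scaledWave j` has slope `±1` on the dyadic intervals of order `j + 1`. -/
theorem exists_scaledWave_sub_eq_of_dyadic (j : ℕ) (n : ℤ) :
    ∃ σ : ℝ, |σ| = 1 ∧ ∀ u ∈ Icc ((n : ℝ) / 2 ^ (j + 1)) ((n + 1 : ℤ) / 2 ^ (j + 1)),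
      ∀ v ∈ Icc ((n : ℝ) / 2 ^ (j + 1)) ((n + 1 : ℤ) / 2 ^ (j + 1)),
        scaledWave j u - scaledWave j v = σ * (u - v) := by
  have key : ∃ m : ℤ, 2 * m - 1 ≤ n ∧ n + 1 ≤ 2 * m + 1 := ⟨(n + 1) / 2, by omega, by omega⟩
  obtain ⟨m, hm, hm'⟩ := key
  have hmr : 2 * (m : ℝ) - 1 ≤ n := by exact_mod_cast hm
  have hmr' : ((n + 1 : ℤ) : ℝ) ≤ 2 * m + 1 := by exact_mod_cast hm'
  obtain ⟨σ, hσ, h⟩ := exists_scaledWave_sub_eq j m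
  have hin : ∀ u ∈ Icc ((n : ℝ) / 2 ^ (j + 1)) ((n + 1 : ℤ) / 2 ^ (j + 1)),
      |2 ^ j * u - (m : ℝ)| ≤ 1 / 2 := fun u hu => by
    have h1 := (div_le_iff₀ (by positivity)).1 hu.1
    have h2 := (le_div_iff₀ (by positivity)).1 hu.2
    have e : u * (2 : ℝ) ^ (j + 1) = 2 * (2 ^ j * u) := by ring
    rw [e] at h1 h2
    rw [abs_le]
    constructor <;> linarith
  exact ⟨σ, hσ, fun u hu v hv => h u v (hin u hu) (hin v hv)⟩

theorem not_differentiableAt_waveSum (x : ℝ) : ¬ DifferentiableAt ℝ waveSum x := by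
  intro hdiff
  set a : ℕ → ℝ := fun k => (⌊2 ^ k * x⌋ : ℝ) / 2 ^ k with ha
  set b : ℕ → ℝ := fun k => ((⌊2 ^ k * x⌋ + 1 : ℤ) : ℝ) / 2 ^ k with hb
  have hp : ∀ k : ℕ, (0 : ℝ) < 2 ^ k := fun k => by positivity
  have hba : ∀ k, b k - a k = (1 / 2) ^ k := fun k => by
    simp only [ha, hb]; push_cast; rw [← sub_div, one_div_pow]; congr 1; ring
  have hax : ∀ k, a k ≤ x := fun k => by
    simp only [ha]; rw [div_le_iff₀ (hp k), mul_comm]; exact Int.floor_le _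
  have hxb : ∀ k, x ≤ b k := fun k => by
    simp only [hb]; rw [le_div_iff₀ (hp k), mul_comm]; push_cast
    exact (Int.lt_floor_add_one _).le
  have hab : ∀ k, a k ≤ b k := fun k => (hax k).trans (hxb k)
  choose σ hσ hslope using fun j => exists_scaledWave_sub_eq_of_dyadic j ⌊2 ^ (j + 1) * x⌋
  have hquot : ∀ k, waveSum (b k) - waveSum (a k) =
      (∑ j ∈ Finset.range k, σ j) * (b k - a k) := fun k => by
    rw [waveSum_eq_sum_of_dyadic k ⌊2 ^ k * x⌋, waveSum_eq_sum_of_dyadic k (⌊2 ^ k * x⌋ + 1),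
      ← Finset.sum_sub_distrib, Finset.sum_mul]
    refine Finset.sum_congr rfl fun j hj => ?_
    have hjk : j + 1 ≤ k := Finset.mem_range.1 hj
    have h1 : a (j + 1) ≤ a k := monotone_dyadic_floor x hjk
    have h2 : b k ≤ b (j + 1) := antitone_dyadic_floor_add_one x hjk
    exact hslope j _ ⟨h1.trans (hab k), h2⟩ _ ⟨h1, (hab k).trans h2⟩
  set L := deriv waveSum x
  have hev := hdiff.hasDerivAt.isLittleO.def (by norm_num : (0 : ℝ) < 1 / 4)
  obtain ⟨r, hr, hball⟩ := Metric.eventually_nhds_iff.1 hev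
  obtain ⟨k, hk⟩ := exists_pow_lt_of_lt_one hr (by norm_num : (1 : ℝ) / 2 < 1)
  -- Since `a l ≤ x ≤ b l`, the errors at both ends add up to at most `1 / 4` of the length. Two
  -- successive partial sums then differ by at most `1 / 2`, yet they differ by `±1`.
  have hclose : ∀ l, k ≤ l → |∑ j ∈ Finset.range l, σ j - L| ≤ 1 / 4 := fun l hl => by
    have hlen : b l - a l < r := by
      rw [hba]
      exact (pow_le_pow_of_le_one (by norm_num) (by norm_num) hl).trans_lt hk
    have hpos : 0 < b l - a l := by rw [hba]; positivity
    have h1 := hball (y := a l) (by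
      rw [Real.dist_eq, abs_of_nonpos] <;> linarith [hax l, hxb l])
    have h2 := hball (y := b l) (by
      rw [Real.dist_eq, abs_of_nonneg] <;> linarith [hax l, hxb l])
    rw [Real.norm_eq_abs, Real.norm_eq_abs, smul_eq_mul,
      abs_of_nonpos (sub_nonpos.2 (hax l)), abs_le] at h1
    rw [Real.norm_eq_abs, Real.norm_eq_abs, smul_eq_mul,
      abs_of_nonneg (sub_nonneg.2 (hxb l)), abs_le] at h2
    have h3 := hquot l
    have h4 : |(∑ j ∈ Finset.range l, σ j - L) * (b l - a l)| ≤ 1 / 4 * (b l - a l) := by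
      rw [sub_mul, ← h3, abs_le]
      constructor <;> linarith [h1.1, h1.2, h2.1, h2.2]
    rw [abs_mul, abs_of_pos hpos] at h4
    exact le_of_mul_le_mul_right h4 hpos
  have h1 := hclose k le_rfl
  have h2 := hclose (k + 1) k.le_succ
  rw [Finset.sum_range_succ] at h2
  have h3 : |σ k| ≤ 1 / 2 := by
    rw [abs_le] at h1 h2 ⊢
    constructor <;> linarith
  rw [hσ] at h3
  norm_num at h3

/-! ### Monotonicity of the graph -/

/-- If on every interval `f` is affine up to a sufficiently small multiple of the length, then the
graph of `f` is symmetrically monotone. -/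
theorem symmetricallyMonotone_planeGraph {c η : ℝ} (hη : (c + 1) * η ≤ c - 1) (hc : 1 < c)
    {f : ℝ → ℝ} (S : Set ℝ)
    (hf : ∀ x z, x < z → ∃ s : ℝ, ∀ u ∈ Icc x z, ∀ v ∈ Icc x z,
      |f u - f v - s * (u - v)| ≤ η * (z - x)) :
    SymmetricallyMonotone c (planeGraph f S) := by
  have hinj : Function.Injective fun p : planeGraph f S => p.1 0 := by
    rintro ⟨_, u, hu, rfl⟩ ⟨_, v, hv, rfl⟩ h
    have h' : u = v := h
    subst h'
    rfl
  refine ⟨LinearOrder.lift' _ hinj, ?_⟩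
  rintro ⟨_, x, hx, rfl⟩ ⟨_, y, hy, rfl⟩ ⟨_, z, hz, rfl⟩ hxy hyz
  replace hxy : x < y := hxy
  replace hyz : y < z := hyz
  obtain ⟨s, hs⟩ := hf x z (hxy.trans hyz)
  set P : ℝ → EuclideanSpace ℝ (Fin 2) := fun t => !₂[t, f t] with hP
  change max (dist (P x) (P y)) (dist (P y) (P z)) ≤ c * dist (P x) (P z)
  -- The chord from `v` to `u` is close to `(u - v) • w`. As `‖w‖ ≥ 1`, the error stays relatively
  -- small however steep `s` is.
  set w : EuclideanSpace ℝ (Fin 2) := !₂[1, s] with hw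
  have hw1 : 1 ≤ ‖w‖ := by
    simpa [hw] using PiLp.norm_apply_le w 0
  have happrox : ∀ u ∈ Icc x z, ∀ v ∈ Icc x z, ‖P u - P v - (u - v) • w‖ ≤ η * (z - x) := by
    intro u hu v hv
    have e : P u - P v - (u - v) • w = PiLp.single 2 1 (f u - f v - s * (u - v)) := by
      ext i
      fin_cases i
      · simp [hP, hw]
      · simp [hP, hw, mul_comm]
    rw [e, PiLp.norm_single]
    exact hs u hu v hv
  have hupper : ∀ u ∈ Icc x z, ∀ v ∈ Icc x z,
      dist (P u) (P v) ≤ (z - x) * ‖w‖ + η * (z - x) := by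
    intro u hu v hv
    have h1 := norm_sub_norm_le (P u - P v) ((u - v) • w)
    have h2 := happrox u hu v hv
    have h3 : |u - v| ≤ z - x := by
      rw [abs_le]
      constructor <;> linarith [hu.1, hu.2, hv.1, hv.2]
    rw [norm_smul, Real.norm_eq_abs] at h1
    rw [dist_eq_norm]
    linarith [mul_le_mul_of_nonneg_right h3 (norm_nonneg w)]
  have hx' : x ∈ Icc x z := ⟨le_rfl, by linarith⟩
  have hy' : y ∈ Icc x z := ⟨hxy.le, hyz.le⟩
  have hz' : z ∈ Icc x z := ⟨by linarith, le_rfl⟩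
  have hlower : (z - x) * ‖w‖ - η * (z - x) ≤ dist (P x) (P z) := by
    have h1 := norm_sub_norm_le ((x - z) • w) (P x - P z)
    have h2 := happrox x hx' z hz'
    rw [norm_sub_rev] at h2
    rw [norm_smul, Real.norm_eq_abs, abs_of_nonpos (by linarith)] at h1
    rw [dist_eq_norm]
    linarith
  have hfinal : (z - x) * ‖w‖ + η * (z - x) ≤ c * ((z - x) * ‖w‖ - η * (z - x)) := by
    have h1 : (c + 1) * η ≤ (c - 1) * ‖w‖ :=
      hη.trans (le_mul_of_one_le_right (by linarith) hw1)
    have h2 := mul_le_mul_of_nonneg_right h1 (by linarith : 0 ≤ z - x)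
    linarith
  have hbound := hfinal.trans (mul_le_mul_of_nonneg_left hlower (by linarith : 0 ≤ c))
  exact max_le ((hupper x hx' y hy').trans hbound) ((hupper y hy' z hz').trans hbound)

theorem mainTheorem4 (c : ℝ) (hc : 1 < c) :
    ∃ f : ℝ → ℝ, ContinuousOn f (Set.Icc 0 1) ∧
      AlmostNowhereDifferentiableOn f (Set.Icc 0 1) ∧
      SymmetricallyMonotone c (planeGraph f (Set.Icc 0 1)) := by
  -- Chosen so that `η = 5 * ε` satisfies `(c + 1) * η = c - 1`.
  set ε : ℝ := (c - 1) / (c + 1) / 5 with hε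
  have hc1 : 0 < c + 1 := by linarith
  have hε0 : 0 < ε := div_pos (div_pos (by linarith) hc1) (by norm_num)
  refine ⟨fun x => ε * waveSum x, (continuous_const.mul continuous_waveSum).continuousOn,
    almostNowhereDifferentiableOn_Icc 0 1 fun x hx => not_differentiableAt_waveSum x ?_,
    symmetricallyMonotone_planeGraph (η := 5 * ε) ?_ hc _ fun x z hxz => ?_⟩
  · simpa [hε0.ne'] using hx.const_mul ε⁻¹
  · rw [hε]
    field_simp
    exact le_rfl
  · obtain ⟨s, hs⟩ := exists_abs_waveSum_sub_le hxz
    refine ⟨ε * s, fun u hu v hv => ?_⟩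
    have e : ε * waveSum u - ε * waveSum v - ε * s * (u - v) =
        ε * (waveSum u - waveSum v - s * (u - v)) := by ring
    rw [e, abs_mul, abs_of_pos hε0]
    linarith [mul_le_mul_of_nonneg_left (hs u hu v hv) hε0.le]
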